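/- **Proposition 4.2.** Let $\beta\in(0,1)$ and let $f_0:[0,1]\to\mathbb R$ satisfy - (H1) $f_0(r)=\tilde f_0(r^2)$ for $r\in[0,1]$, with $\tilde f_0\in\mathscr C^{2,\beta}([0,1])$; - (H2) $\inf_{r\in(0,1]}\frac{f_0'(r)}{r}>0$. Put $$\kappa_1=\inf_{r\in[0,1]}\int_0^1 s f_0(rs)\,ds,\qquad \kappa_2=\sup_{r\in[0,1]}\int_0^1 s f_0(rs)\,ds,$$ and for $\Omega\notin[\kappa_1,\kappa_2]$ and $r\in[0,1]$ $$\mu_\Omega^0(r)=\frac{f_0'(r)}{r\left(\Omega-\int_0^1 sf_0(rs)\,ds\right)},\qquad \nu_\Omega(r)=|\mu^0_\Omega(r)|,\qquad d\lambda_\Omega(s)=\frac{s}{\nu_\Omega(s)}\,ds \ \text{ on } [0,1],$$ where $f_0'(r)/r$ is extended to $r=0$ by its limit. Let $L^2_\Omega=L^2(\lambda_\Omega)$ be the real Hilbert space of (classes of) $\lambda_\Omega$-square-integrable functions on $[0,1]$, and for $h\in L^2_\Omega$ set $$\mathcal L_0^\Omega[h](r)=\nu_\Omega(r)\int_r^1\frac1\tau\int_0^\tau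 s\,h(s)\,ds\,d\tau,\qquad \mathbb L_0^\Omega[h](r)=\frac{h(r)}{\mu^0_\Omega(r)}-\int_r^1\frac1\tau\int_0^\tau s\,h(s)\,ds\,d\tau .$$ Then: 1. For every $\Omega\notin[\kappa_1,\kappa_2]$, the integrals above converge absolutely for every $h\in L^2_\Omega$, and $\mathcal L_0^\Omega$ is a bounded, self-adjoint, positive-definite (i.e. $\langle\mathcal L_0^\Omega h,h\rangle_{L^2_\Omega}>0$ for all $h\neq0$), compact and Hilbert–Schmidt operator from $L^2_\Omega$ to $L^2_\Omega$. 2. If $\Omega<\kappa_1$, then the kernel of $\mathbb L_0^\Omega$ in $L^2_\Omega$ is $\{0\}$. 3. There is a finite set $\mathbb S\subset(\kappa_2,\infty)$ such that, for every $\Omega\in(\kappa_2,\infty)\setminus\mathbb S$, the kernel of $\mathbb L_0^\Omega$ in $L^2_\Omega$ is $\{0\}$. -/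

import Mathlib

open MeasureTheory Set
open scoped NNReal ENNReal

noncomputable section

namespace RadialVortex

/-- The Hölder space `C^{2,β}([0,1])`: twice continuously differentiable up to the boundary, with a
`β`-Hölder second derivative. -/
def HolderC2 (β : ℝ≥0) (g : ℝ → ℝ) : Prop :=
  ContDiffOn ℝ 2 g (Icc 0 1) ∧
    ∃ C : ℝ≥0, HolderOnWith C β (iteratedDerivWithin 2 g (Icc 0 1)) (Icc 0 1)

/-- The derivative `f₀'` on `[0,1]` (one-sided at the end points). Only the values of `f₀` on
`[0,1]` matter. -/
def profileDeriv (f₀ : ℝ → ℝ) (r : ℝ) : ℝ :=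
  derivWithin f₀ (Icc 0 1) r

/-- Smoothness of the profile: `f₀(r) = f̃₀(r²)` on `[0,1]`, with `f̃₀ ∈ C^{2,β}([0,1])`. -/
def SmoothProfile (β : ℝ≥0) (f₀ : ℝ → ℝ) : Prop :=
  ∃ g : ℝ → ℝ, HolderC2 β g ∧ ∀ r ∈ Icc (0 : ℝ) 1, f₀ r = g (r ^ 2)

/-- Strict monotonicity of the profile: `inf_{r ∈ (0,1]} f₀'(r)/r > 0`. -/
def MonotoneProfile (f₀ : ℝ → ℝ) : Prop :=
  0 < sInf ((fun r => profileDeriv f₀ r / r) '' Ioc 0 1)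

/-- The function `r ↦ ∫₀¹ s f₀(rs) ds`. -/
def meanProfile (f₀ : ℝ → ℝ) (r : ℝ) : ℝ :=
  ∫ s in (0 : ℝ)..1, s * f₀ (r * s)

/-- `κ₁ = inf_{r ∈ [0,1]} ∫₀¹ s f₀(rs) ds`. -/
def kappa₁ (f₀ : ℝ → ℝ) : ℝ := sInf (meanProfile f₀ '' Icc 0 1)

/-- `κ₂ = sup_{r ∈ [0,1]} ∫₀¹ s f₀(rs) ds`. -/
def kappa₂ (f₀ : ℝ → ℝ) : ℝ := sSup (meanProfile f₀ '' Icc 0 1)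

/-- The function `r ↦ f₀'(r)/r`, extended to `r = 0` by its limit `f₀''(0)`. -/
def derivOverR (f₀ : ℝ → ℝ) (r : ℝ) : ℝ :=
  if r = 0 then derivWithin (profileDeriv f₀) (Icc 0 1) 0 else profileDeriv f₀ r / r

/-- `μ_Ω⁰(r) = f₀'(r) / (r (Ω - ∫₀¹ s f₀(rs) ds))`. -/
def mu (f₀ : ℝ → ℝ) (Ω r : ℝ) : ℝ :=
  derivOverR f₀ r / (Ω - meanProfile f₀ r)

/-- `ν_Ω = |μ_Ω⁰|`. -/
def nu (f₀ : ℝ → ℝ) (Ω r : ℝ) : ℝ := |mu f₀ Ω r|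

/-- The measure `dλ_Ω(s) = s / ν_Ω(s) ds` on `[0,1]`. -/
def lam (f₀ : ℝ → ℝ) (Ω : ℝ) : Measure ℝ :=
  (volume.restrict (Icc 0 1)).withDensity fun s => ENNReal.ofReal (s / nu f₀ Ω s)

/-- The real Hilbert space `L²_Ω = L²(λ_Ω)`. -/
abbrev L2 (f₀ : ℝ → ℝ) (Ω : ℝ) : Type := Lp ℝ 2 (lam f₀ Ω)

/-- `τ ↦ (1/τ) ∫₀^τ s h(s) ds`. -/
def radialAverage (h : ℝ → ℝ) (τ : ℝ) : ℝ :=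
  1 / τ * ∫ s in (0 : ℝ)..τ, s * h s

/-- `r ↦ ∫_r^1 (1/τ) ∫₀^τ s h(s) ds dτ`. -/
def radialPotential (h : ℝ → ℝ) (r : ℝ) : ℝ :=
  ∫ τ in r..1, radialAverage h τ

/-- `𝓛_0^Ω[h](r) = ν_Ω(r) ∫_r^1 (1/τ) ∫₀^τ s h(s) ds dτ`. -/
def calL₀ (f₀ : ℝ → ℝ) (Ω : ℝ) (h : ℝ → ℝ) (r : ℝ) : ℝ :=
  nu f₀ Ω r * radialPotential h r

/-- `𝕃_0^Ω[h](r) = h(r) / μ_Ω⁰(r) - ∫_r^1 (1/τ) ∫₀^τ s h(s) ds dτ`. -/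
def bbL₀ (f₀ : ℝ → ℝ) (Ω : ℝ) (h : ℝ → ℝ) (r : ℝ) : ℝ :=
  h r / mu f₀ Ω r - radialPotential h r

/-- The kernel of `𝕃_0^Ω` in `L²_Ω`. -/
def kerL₀ (f₀ : ℝ → ℝ) (Ω : ℝ) : Set (L2 f₀ Ω) :=
  {h | bbL₀ f₀ Ω h =ᵐ[lam f₀ Ω] 0}

/-- A bounded operator is Hilbert–Schmidt if `∑ᵢ ‖T eᵢ‖² < ∞` for every Hilbert basis `(eᵢ)`. -/
def IsHilbertSchmidt {E : Type*} [NormedAddCommGroup E] [InnerProductSpace ℝ E]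
    (T : E →L[ℝ] E) : Prop :=
  ∀ (s : Set E) (b : HilbertBasis s ℝ E), Summable fun i => ‖T (b i)‖ ^ 2

end RadialVortex

end

open RadialVortex

/-!
On `L²(s / v(s) ds)` the map `A h = radialAverage h`, with values in `L²(s ds)`, is Hilbert–Schmidt
with squared norm `∫₀¹ radialAverage v`, and an integration by parts gives
`A† A h = v * radialPotential h`. For `v = ν_Ω` this factorizes `𝓛_0^Ω`, whence all of part 1, and
part 2 as well, where `𝕃_0^Ω h = 0` reads `A† A h = -h`.

For `Ω > κ₂` write `1 / μ_Ω = (Ω - κ₂) / w + 1 / v` with `w = f₀'(r) / r` and `v = μ_κ₂`. A kernel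
element is then an eigenvector, with eigenvalue `Ω - κ₂ > 0`, of one symmetric operator on
`L²(s / w(s) ds)` that does not depend on `Ω` and has quadratic form `‖A h‖² - ‖h‖²`, the last norm
being that of `L²(s / v(s) ds)`. On the span of the eigenvectors with positive eigenvalue `A`
expands this norm, so by the Birman–Schwinger bound the span has dimension at most the squared
Hilbert–Schmidt norm of `A` on `L²(s / v(s) ds)`. That norm is finite because `v` has at worst a
simple pole at `r = 1`.
-/

noncomputable section

namespace RadialVortex

section HilbertSchmidt

variable {E F : Type*} [NormedAddCommGroup E] [InnerProductSpace ℝ E]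
  [NormedAddCommGroup F] [InnerProductSpace ℝ F]

/-- The squared Hilbert–Schmidt norm of `S` is at most `M`: the sums `∑ᵢ ‖S eᵢ‖²` over finite
orthonormal families are bounded by `M`. -/
def HilbertSchmidtSqLE (S : E →L[ℝ] F) (M : ℝ) : Prop :=
  ∀ (n : ℕ) (e : Fin n → E), Orthonormal ℝ e → ∑ i, ‖S (e i)‖ ^ 2 ≤ M

lemma HilbertSchmidtSqLE.sum_le {S : E →L[ℝ] F} {M : ℝ} (h : HilbertSchmidtSqLE S M)
    {ι : Type*} {e : ι → E} (he : Orthonormal ℝ e) (t : Finset ι) :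
    ∑ i ∈ t, ‖S (e i)‖ ^ 2 ≤ M := by
  have hle := h t.card (fun j => e (t.equivFin.symm j))
    (he.comp _ (Subtype.val_injective.comp t.equivFin.symm.injective))
  rwa [t.equivFin.symm.sum_comp (fun x : t => ‖S (e x)‖ ^ 2),
    Finset.sum_coe_sort t (fun x => ‖S (e x)‖ ^ 2)] at hle

lemma HilbertSchmidtSqLE.isHilbertSchmidt_comp {S : E →L[ℝ] F} {M : ℝ}
    (h : HilbertSchmidtSqLE S M) (R : F →L[ℝ] E) : IsHilbertSchmidt (R ∘L S) := by
  intro s b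
  have hS : Summable fun i => ‖S (b i)‖ ^ 2 :=
    summable_of_sum_le (fun i => by positivity) fun t => h.sum_le b.orthonormal t
  refine (hS.mul_left (‖R‖ ^ 2)).of_nonneg_of_le (fun i => by positivity) fun i => ?_
  rw [← mul_pow]
  gcongr
  exact R.le_opNorm _

lemma norm_sum_rankOne_le {ι : Type*} {e : ι → E} (he : Orthonormal ℝ e) (y : ι → F)
    (t : Finset ι) :
    ‖∑ i ∈ t, InnerProductSpace.rankOne ℝ (y i) (e i)‖ ≤ √(∑ i ∈ t, ‖y i‖ ^ 2) := by
  refine ContinuousLinearMap.opNorm_le_bound _ (Real.sqrt_nonneg _) fun x => ?_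
  calc ‖(∑ i ∈ t, InnerProductSpace.rankOne ℝ (y i) (e i)) x‖
      ≤ ∑ i ∈ t, ‖y i‖ * ‖inner ℝ (e i) x‖ := by
        simp only [sum_apply, InnerProductSpace.rankOne_apply]
        refine norm_sum_le_of_le _ fun i _ => ?_
        rw [norm_smul, mul_comm]
    _ ≤ √(∑ i ∈ t, ‖y i‖ ^ 2) * √(∑ i ∈ t, ‖inner ℝ (e i) x‖ ^ 2) :=
        Real.sum_mul_le_sqrt_mul_sqrt _ _ _
    _ ≤ √(∑ i ∈ t, ‖y i‖ ^ 2) * ‖x‖ := by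
        gcongr
        exact Real.sqrt_le_iff.2 ⟨norm_nonneg x, he.sum_inner_products_le x⟩

lemma summable_rankOne [CompleteSpace F] {ι : Type*} {e : ι → E} (he : Orthonormal ℝ e)
    {y : ι → F} (hy : Summable fun i => ‖y i‖ ^ 2) :
    Summable fun i => InnerProductSpace.rankOne ℝ (y i) (e i) := by
  refine summable_iff_vanishing_norm.2 fun ε hε => ?_
  obtain ⟨s, hs⟩ := summable_iff_vanishing_norm.1 hy (ε ^ 2) (by positivity)
  refine ⟨s, fun t ht => (norm_sum_rankOne_le he y t).trans_lt ?_⟩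
  exact (Real.sqrt_lt' hε).2 ((le_abs_self _).trans_lt (hs t ht))

lemma isCompactOperator_rankOne (x : F) (y : E) :
    IsCompactOperator (InnerProductSpace.rankOne ℝ x y) :=
  (isCompactOperator_of_locallyCompactSpace_rng
    (ContinuousLinearMap.toSpanSingleton ℝ x)).comp_clm (innerSL ℝ y)

lemma IsHilbertSchmidt.isCompactOperator [CompleteSpace E] {T : E →L[ℝ] E}
    (hT : IsHilbertSchmidt T) : IsCompactOperator T := by
  obtain ⟨s, b, -⟩ := exists_hilbertBasis ℝ E
  have hsum : HasSum (fun i => InnerProductSpace.rankOne ℝ (T (b i)) (b i)) T := by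
    have hb := summable_rankOne b.orthonormal (hT s b)
    convert hb.hasSum using 1
    ext x
    refine HasSum.unique ?_ (hb.hasSum.mapL (ContinuousLinearMap.apply ℝ E x))
    simpa [b.repr_apply_apply] using (b.hasSum_repr x).mapL T
  refine isCompactOperator_of_tendsto hsum (.of_forall fun t => ?_)
  exact (compactOperator (RingHom.id ℝ) E E).sum_mem fun i _ => isCompactOperator_rankOne _ _

end HilbertSchmidt

section BirmanSchwinger

variable {E F G : Type*} [NormedAddCommGroup E] [InnerProductSpace ℝ E]
  [NormedAddCommGroup F] [InnerProductSpace ℝ F] [NormedAddCommGroup G] [InnerProductSpace ℝ G]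

lemma HilbertSchmidtSqLE.finrank_le {S : E →L[ℝ] F} {M : ℝ} (h : HilbertSchmidtSqLE S M)
    (V : Submodule ℝ E) [FiniteDimensional ℝ V] (hV : ∀ x ∈ V, ‖x‖ ≤ ‖S x‖) :
    (Module.finrank ℝ V : ℝ) ≤ M := by
  let e := stdOrthonormalBasis ℝ V
  have he : Orthonormal ℝ fun i => (e i : E) := e.orthonormal.comp_linearIsometry V.subtypeₗᵢ
  calc (Module.finrank ℝ V : ℝ) = ∑ i, ‖(e i : E)‖ ^ 2 := by simp [he.1]
    _ ≤ ∑ i, ‖S (e i)‖ ^ 2 := by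
        gcongr with i
        exact hV _ (e i).2
    _ ≤ M := h _ _ he

lemma inner_sum_eigenvectors {B : Module.End ℝ G} (hB : LinearMap.IsSymmetric B)
    {t : Finset ℝ} {y : t → G} (hy : ∀ l : t, B.HasEigenvector l (y l)) (c : t → ℝ) :
    inner ℝ (B (∑ l, c l • y l)) (∑ l, c l • y l) = ∑ l : t, l * ‖c l • y l‖ ^ 2 := by
  have horth : Pairwise fun l m : t => inner ℝ (y l) (y m) = 0 := fun l m hlm =>
    hB.orthogonalFamily_eigenspaces (Subtype.coe_injective.ne hlm)
      ⟨y l, (hy l).1⟩ ⟨y m, (hy m).1⟩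
  simp only [map_sum, map_smul, (hy _).apply_eq_smul, sum_inner, inner_sum]
  refine Finset.sum_congr rfl fun l _ => ?_
  rw [Finset.sum_eq_single l _ (by simp), smul_comm, real_inner_smul_left,
    real_inner_self_eq_norm_sq]
  intro m _ hml
  simp [real_inner_smul_left, real_inner_smul_right, horth hml]

lemma exists_submodule_inner_pos {B : Module.End ℝ G} (hB : LinearMap.IsSymmetric B) {t : Finset ℝ}
    (ht : ∀ l ∈ t, 0 < l ∧ B.HasEigenvalue l) :
    ∃ V : Submodule ℝ G, Module.finrank ℝ V = t.card ∧ FiniteDimensional ℝ V ∧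
      ∀ x ∈ V, x ≠ 0 → 0 < inner ℝ (B x) x := by
  choose y hy using fun l : t => (ht l l.2).2.exists_hasEigenvector
  have hli : LinearIndependent ℝ y :=
    Module.End.eigenvectors_linearIndependent' B _ Subtype.coe_injective y hy
  refine ⟨Submodule.span ℝ (range y), by simp [finrank_span_eq_card hli],
    FiniteDimensional.span_of_finite ℝ (finite_range y), fun x hx hx0 => ?_⟩
  obtain ⟨c, rfl⟩ := (Submodule.mem_span_range_iff_exists_fun ℝ).1 hx
  rw [inner_sum_eigenvectors hB hy]
  have hterm : ∀ l : t, 0 ≤ (l : ℝ) * ‖c l • y l‖ ^ 2 := fun l =>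
    mul_nonneg (ht l l.2).1.le (sq_nonneg _)
  obtain ⟨l, -, hl⟩ := Finset.exists_ne_zero_of_sum_ne_zero hx0
  refine Finset.sum_pos' (fun l _ => hterm l) ⟨l, Finset.mem_univ l, ?_⟩
  exact mul_pos (ht l l.2).1 (by positivity)

/-- A Birman–Schwinger bound: on the span of the corresponding eigenvectors, `ι` is injective and
`‖ι x‖ ≤ ‖S (ι x)‖`, so that the dimension is at most the squared Hilbert–Schmidt norm of `S`. -/
lemma HilbertSchmidtSqLE.finite_setOf_hasEigenvalue {S : E →L[ℝ] F} {M : ℝ}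
    (h : HilbertSchmidtSqLE S M) (ι : G →L[ℝ] E) {B : Module.End ℝ G} (hB : LinearMap.IsSymmetric B)
    (hform : ∀ x, inner ℝ (B x) x = ‖S (ι x)‖ ^ 2 - ‖ι x‖ ^ 2) :
    {l : ℝ | 0 < l ∧ B.HasEigenvalue l}.Finite := by
  by_contra hinf
  obtain ⟨n, hn⟩ := exists_nat_gt M
  obtain ⟨t, ht, rfl⟩ := Set.Infinite.exists_subset_card_eq hinf n
  obtain ⟨V, hcard, hfin, hpos⟩ := exists_submodule_inner_pos hB ht
  have hlt : ∀ x ∈ V, x ≠ 0 → ‖ι x‖ ^ 2 < ‖S (ι x)‖ ^ 2 := fun x hx hx0 => by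
    simpa [hform] using hpos x hx hx0
  have hinj : Function.Injective ((ι : G →ₗ[ℝ] E).domRestrict V) := by
    refine (injective_iff_map_eq_zero _).2 fun x hx => ?_
    have hx' : ι x = 0 := hx
    by_contra hx0
    simpa [hx'] using hlt x x.2 (by simpa using hx0)
  have hrank := h.finrank_le (LinearMap.range ((ι : G →ₗ[ℝ] E).domRestrict V)) ?_
  · rw [LinearMap.finrank_range_of_inj hinj, hcard] at hrank
    exact hn.not_ge hrank
  · rintro _ ⟨x, rfl⟩
    rcases eq_or_ne x 0 with rfl | hx0
    · simp
    · exact (lt_of_pow_lt_pow_left₀ 2 (norm_nonneg _) (hlt x x.2 (by simpa using hx0))).le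

end BirmanSchwinger

section Primitives

variable {a b : ℝ} {f g : ℝ → ℝ}

lemma integral_mul_integral_swap (hf : IntervalIntegrable f volume a b)
    (hg : IntervalIntegrable g volume a b) :
    ∫ s in a..b, g s * ∫ τ in s..b, f τ = ∫ τ in a..b, f τ * ∫ s in a..τ, g s := by
  have hparts := (hg.absolutelyContinuousOnInterval_intervalIntegral left_mem_uIcc)
    |>.integral_mul_deriv_eq_deriv_mul
      (hf.absolutelyContinuousOnInterval_intervalIntegral right_mem_uIcc)
  simp only [intervalIntegral.integral_same, mul_zero, zero_mul, zero_sub, sub_zero] at hparts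
  calc ∫ s in a..b, g s * ∫ τ in s..b, f τ
      = -∫ s in a..b, deriv (fun x => ∫ t in a..x, g t) s * ∫ τ in b..s, f τ := by
        rw [← intervalIntegral.integral_neg]
        refine intervalIntegral.integral_congr_ae ?_
        filter_upwards [hg.ae_hasDerivAt_integral] with s hs hsm
        rw [(hs (uIoc_subset_uIcc hsm) a left_mem_uIcc).deriv,
          intervalIntegral.integral_symm b s, mul_neg]
    _ = ∫ τ in a..b, (∫ s in a..τ, g s) * deriv (fun x => ∫ t in b..x, f t) τ := hparts.symm
    _ = ∫ τ in a..b, f τ * ∫ s in a..τ, g s := by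
        refine intervalIntegral.integral_congr_ae ?_
        filter_upwards [hf.ae_hasDerivAt_integral] with s hs hsm
        rw [(hs (uIoc_subset_uIcc hsm) b right_mem_uIcc).deriv, mul_comm]

lemma ae_eq_zero_of_integral_ae_eq_zero (hab : a ≤ b) (hf : IntervalIntegrable f volume a b)
    (h0 : ∀ᵐ τ ∂volume.restrict (Ioo a b), ∫ s in a..τ, f s = 0) :
    f =ᵐ[volume.restrict (Ioo a b)] 0 := by
  have hcont : ContinuousOn (fun τ => ∫ s in a..τ, f s) (Icc a b) := by
    simpa only [uIcc_of_le hab] using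
      intervalIntegral.continuousOn_primitive_interval' hf left_mem_uIcc
  have hzero : EqOn (fun τ => ∫ s in a..τ, f s) 0 (Ioo a b) :=
    Measure.eqOn_open_of_ae_eq h0 isOpen_Ioo (hcont.mono Ioo_subset_Icc_self) continuousOn_const
  filter_upwards [ae_restrict_of_ae hf.ae_hasDerivAt_integral, ae_restrict_mem measurableSet_Ioo]
    with x hx hxm
  have hderiv := hx (uIcc_of_le hab ▸ Ioo_subset_Icc_self hxm) a left_mem_uIcc
  exact hderiv.unique ((hasDerivAt_const x (0 : ℝ)).congr_of_eventuallyEq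
    (hzero.eventuallyEq_of_mem (isOpen_Ioo.mem_nhds hxm)))

end Primitives

section RadialMeasure

/-- Lebesgue measure on the unit interval. The end points are removed, since the weights of
interest may blow up there. -/
abbrev unitVol : Measure ℝ := volume.restrict (Ioo 0 1)

lemma ae_unitVol_mem : ∀ᵐ s ∂unitVol, s ∈ Ioo (0 : ℝ) 1 := ae_restrict_mem measurableSet_Ioo

lemma integrable_unitVol_iff {f : ℝ → ℝ} :
    Integrable f unitVol ↔ IntervalIntegrable f volume 0 1 :=
  (intervalIntegrable_iff_integrableOn_Ioo_of_le zero_le_one).symm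

lemma integral_unitVol (f : ℝ → ℝ) : ∫ s, f s ∂unitVol = ∫ s in (0 : ℝ)..1, f s := by
  rw [intervalIntegral.integral_of_le zero_le_one, integral_Ioc_eq_integral_Ioo]

/-- The measure `s / v(s) ds` on `[0,1]`; for example `λ_Ω` has weight `v = ν_Ω`. -/
def radialMeasure (v : ℝ → ℝ) : Measure ℝ :=
  (volume.restrict (Icc 0 1)).withDensity fun s => ENNReal.ofReal (s / v s)

lemma radialMeasure_eq (v : ℝ → ℝ) :
    radialMeasure v = unitVol.withDensity fun s => ENNReal.ofReal (s / v s) := by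
  rw [radialMeasure, ← Measure.restrict_congr_set Ioo_ae_eq_Icc]

/-- A measurable positive function on the open unit interval. -/
structure IsRadialWeight (v : ℝ → ℝ) : Prop where
  aemeasurable : AEMeasurable v unitVol
  pos : ∀ s ∈ Ioo (0 : ℝ) 1, 0 < v s

lemma isRadialWeight_one : IsRadialWeight 1 := ⟨aemeasurable_const, fun _ _ => one_pos⟩

lemma radialMeasure_le_smul {u v : ℝ → ℝ} (hu : IsRadialWeight u) (hv : IsRadialWeight v) {c : ℝ}
    (h : ∀ s ∈ Ioo (0 : ℝ) 1, u s ≤ c * v s) :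
    radialMeasure v ≤ ENNReal.ofReal c • radialMeasure u := by
  rw [radialMeasure_eq, radialMeasure_eq, ← withDensity_smul' _ _ ENNReal.ofReal_ne_top]
  refine withDensity_mono ?_
  filter_upwards [ae_unitVol_mem] with s hs
  have hu0 := hu.pos s hs
  have hv0 := hv.pos s hs
  have hc : 0 ≤ c := (pos_of_mul_pos_left (hu0.trans_le (h s hs)) hv0.le).le
  rw [Pi.smul_apply, smul_eq_mul, ← ENNReal.ofReal_mul hc]
  refine ENNReal.ofReal_le_ofReal ?_
  rw [← mul_div_assoc, div_le_div_iff₀ hv0 hu0]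
  nlinarith [mul_le_mul_of_nonneg_left (h s hs) hs.1.le]

namespace IsRadialWeight

variable {v : ℝ → ℝ}

lemma aemeasurable_density (hv : IsRadialWeight v) :
    AEMeasurable (fun s => ENNReal.ofReal (s / v s)) unitVol :=
  (aemeasurable_id.div hv.aemeasurable).ennreal_ofReal

lemma ae_eq (hv : IsRadialWeight v) : ae (radialMeasure v) = ae unitVol := by
  rw [radialMeasure_eq]
  refine le_antisymm (withDensity_absolutelyContinuous _ _).ae_le
    (withDensity_absolutelyContinuous' hv.aemeasurable_density ?_).ae_le
  filter_upwards [ae_unitVol_mem] with s hs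
  exact (ENNReal.ofReal_pos.2 (div_pos hs.1 (hv.pos s hs))).ne'

lemma aestronglyMeasurable_iff (hv : IsRadialWeight v) {f : ℝ → ℝ} :
    AEStronglyMeasurable f (radialMeasure v) ↔ AEStronglyMeasurable f unitVol :=
  ⟨fun h => h.mono_ac (Measure.ae_le_iff_absolutelyContinuous.1 hv.ae_eq.ge),
    fun h => h.mono_ac (Measure.ae_le_iff_absolutelyContinuous.1 hv.ae_eq.le)⟩

lemma integrable_iff (hv : IsRadialWeight v) {f : ℝ → ℝ} :
    Integrable f (radialMeasure v) ↔ Integrable (fun s => s / v s * f s) unitVol := by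
  rw [radialMeasure_eq, integrable_withDensity_iff_integrable_smul₀' hv.aemeasurable_density
    (ae_of_all _ fun s => ENNReal.ofReal_lt_top)]
  refine integrable_congr ?_
  filter_upwards [ae_unitVol_mem] with s hs
  rw [ENNReal.toReal_ofReal (div_pos hs.1 (hv.pos s hs)).le, smul_eq_mul]

lemma memLp_two_iff (hv : IsRadialWeight v) {f : ℝ → ℝ} (hf : AEStronglyMeasurable f unitVol) :
    MemLp f 2 (radialMeasure v) ↔ Integrable (fun s => s / v s * f s ^ 2) unitVol := by
  rw [memLp_two_iff_integrable_sq (hv.aestronglyMeasurable_iff.2 hf), hv.integrable_iff]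

lemma integral_eq (hv : IsRadialWeight v) (f : ℝ → ℝ) :
    ∫ s, f s ∂radialMeasure v = ∫ s, s / v s * f s ∂unitVol := by
  rw [radialMeasure_eq, integral_withDensity_eq_integral_toReal_smul₀ hv.aemeasurable_density
    (ae_of_all _ fun s => ENNReal.ofReal_lt_top)]
  refine integral_congr_ae ?_
  filter_upwards [ae_unitVol_mem] with s hs
  rw [ENNReal.toReal_ofReal (div_pos hs.1 (hv.pos s hs)).le, smul_eq_mul]

lemma inner_eq (hv : IsRadialWeight v) {f g : Lp ℝ 2 (radialMeasure v)} {φ ψ : ℝ → ℝ}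
    (hf : f =ᵐ[unitVol] φ) (hg : g =ᵐ[unitVol] ψ) :
    inner ℝ f g = ∫ s, s / v s * (φ s * ψ s) ∂unitVol := by
  rw [L2.inner_def, hv.integral_eq]
  refine integral_congr_ae ?_
  filter_upwards [hf, hg] with s hs hs'
  rw [hs, hs', Real.inner_apply]

lemma ae_eq_toLp (hv : IsRadialWeight v) {f : ℝ → ℝ} (hf : MemLp f 2 (radialMeasure v)) :
    hf.toLp f =ᵐ[unitVol] f := by
  rw [Filter.EventuallyEq, ← hv.ae_eq]
  exact hf.coeFn_toLp

lemma norm_sq_toLp (hv : IsRadialWeight v) {f : ℝ → ℝ} (hf : MemLp f 2 (radialMeasure v)) :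
    ‖hf.toLp f‖ ^ 2 = ∫ s, s / v s * f s ^ 2 ∂unitVol := by
  rw [← real_inner_self_eq_norm_sq, hv.inner_eq (hv.ae_eq_toLp hf) (hv.ae_eq_toLp hf)]
  simp only [sq]

lemma toLp_eq_zero_iff (hv : IsRadialWeight v) {f : ℝ → ℝ} (hf : MemLp f 2 (radialMeasure v)) :
    hf.toLp f = 0 ↔ f =ᵐ[unitVol] 0 := by
  rw [Lp.eq_zero_iff_ae_eq_zero, Filter.EventuallyEq, hv.ae_eq]
  exact ⟨(hv.ae_eq_toLp hf).symm.trans, (hv.ae_eq_toLp hf).trans⟩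

end IsRadialWeight

end RadialMeasure

section Velocity

lemma integrable_indicator_unitVol_iff {τ : ℝ} (hτ : τ ∈ Icc (0 : ℝ) 1) {f : ℝ → ℝ} :
    Integrable ((Ioo 0 τ).indicator f) unitVol ↔ IntervalIntegrable f volume 0 τ := by
  rw [integrable_indicator_iff measurableSet_Ioo, IntegrableOn,
    Measure.restrict_restrict measurableSet_Ioo, inter_eq_left.2 (Ioo_subset_Ioo_right hτ.2),
    intervalIntegrable_iff_integrableOn_Ioo_of_le hτ.1, IntegrableOn]

lemma integral_indicator_unitVol {τ : ℝ} (hτ : τ ∈ Icc (0 : ℝ) 1) (f : ℝ → ℝ) :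
    ∫ s, (Ioo 0 τ).indicator f s ∂unitVol = ∫ s in (0 : ℝ)..τ, f s := by
  rw [integral_indicator measurableSet_Ioo, Measure.restrict_restrict measurableSet_Ioo,
    inter_eq_left.2 (Ioo_subset_Ioo_right hτ.2), intervalIntegral.integral_of_le hτ.1,
    integral_Ioc_eq_integral_Ioo]

lemma mul_sq_radialAverage (h : ℝ → ℝ) {τ : ℝ} (hτ : 0 < τ) :
    τ * radialAverage h τ ^ 2 = 1 / τ * (∫ s in (0 : ℝ)..τ, s * h s) ^ 2 := by
  rw [radialAverage]
  field_simp

namespace IsRadialWeight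

variable {v : ℝ → ℝ} {τ : ℝ}

lemma mul_indicator_ae_eq (hv : IsRadialWeight v) (τ : ℝ) (h : ℝ → ℝ) :
    (fun s => s / v s * ((Ioo 0 τ).indicator v s * h s))
      =ᵐ[unitVol] (Ioo 0 τ).indicator fun s => s * h s := by
  filter_upwards [ae_unitVol_mem] with s hs
  have hvs := (hv.pos s hs).ne'
  by_cases hm : s ∈ Ioo 0 τ
  · simp only [indicator_of_mem hm]
    field_simp
  · simp only [indicator_of_notMem hm, zero_mul, mul_zero]

lemma memLp_indicator (hv : IsRadialWeight v) (hτ : τ ∈ Icc (0 : ℝ) 1)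
    (hint : IntervalIntegrable (fun s => s * v s) volume 0 τ) :
    MemLp ((Ioo 0 τ).indicator v) 2 (radialMeasure v) := by
  rw [hv.memLp_two_iff (hv.aemeasurable.aestronglyMeasurable.indicator measurableSet_Ioo)]
  refine ((integrable_indicator_unitVol_iff hτ).2 hint).congr ?_
  filter_upwards [hv.mul_indicator_ae_eq τ ((Ioo 0 τ).indicator v)] with s hs
  rw [sq, hs]
  by_cases hm : s ∈ Ioo 0 τ
  · simp only [indicator_of_mem hm]
  · simp only [indicator_of_notMem hm]

lemma exists_inner_eq_integral (hv : IsRadialWeight v) (hτ : τ ∈ Icc (0 : ℝ) 1)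
    (hint : IntervalIntegrable (fun s => s * v s) volume 0 τ) :
    ∃ g : Lp ℝ 2 (radialMeasure v), ‖g‖ ^ 2 = ∫ s in (0 : ℝ)..τ, s * v s ∧
      ∀ h : Lp ℝ 2 (radialMeasure v), inner ℝ g h = ∫ s in (0 : ℝ)..τ, s * h s := by
  have hmem := hv.memLp_indicator hτ hint
  refine ⟨hmem.toLp _, ?_, fun h => ?_⟩
  · rw [hv.norm_sq_toLp, ← integral_indicator_unitVol hτ]
    refine integral_congr_ae ?_
    filter_upwards [hv.mul_indicator_ae_eq τ ((Ioo 0 τ).indicator v)] with s hs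
    rw [sq, hs]
    by_cases hm : s ∈ Ioo 0 τ
    · simp only [indicator_of_mem hm]
    · simp only [indicator_of_notMem hm]
  · rw [hv.inner_eq (hv.ae_eq_toLp hmem) .rfl, integral_congr_ae (hv.mul_indicator_ae_eq τ h),
      integral_indicator_unitVol hτ]

lemma intervalIntegrable_mul (hv : IsRadialWeight v) (hτ : τ ∈ Icc (0 : ℝ) 1)
    (hint : IntervalIntegrable (fun s => s * v s) volume 0 τ) {h : ℝ → ℝ}
    (hh : MemLp h 2 (radialMeasure v)) :
    IntervalIntegrable (fun s => s * h s) volume 0 τ := by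
  have hprod := hv.integrable_iff.1 ((hv.memLp_indicator hτ hint).integrable_mul hh)
  exact (integrable_indicator_unitVol_iff hτ).1 (hprod.congr (hv.mul_indicator_ae_eq τ h))

lemma sum_mul_sq_radialAverage_le (hv : IsRadialWeight v) (hτ : τ ∈ Ioc (0 : ℝ) 1)
    (hint : IntervalIntegrable (fun s => s * v s) volume 0 τ) {n : ℕ}
    {e : Fin n → Lp ℝ 2 (radialMeasure v)} (he : Orthonormal ℝ e) :
    ∑ i, τ * radialAverage (e i) τ ^ 2 ≤ radialAverage v τ := by
  obtain ⟨g, hg, hinner⟩ := hv.exists_inner_eq_integral (Ioc_subset_Icc_self hτ) hint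
  have bessel := he.sum_inner_products_le (s := Finset.univ) g
  simp only [real_inner_comm g, hinner, Real.norm_eq_abs, sq_abs, hg] at bessel
  rw [Finset.sum_congr rfl fun i _ => mul_sq_radialAverage (e i) hτ.1, ← Finset.mul_sum,
    radialAverage]
  exact mul_le_mul_of_nonneg_left bessel (one_div_pos.2 hτ.1).le

lemma mul_sq_radialAverage_le (hv : IsRadialWeight v) (hτ : τ ∈ Ioc (0 : ℝ) 1)
    (hint : IntervalIntegrable (fun s => s * v s) volume 0 τ) (h : Lp ℝ 2 (radialMeasure v)) :
    τ * radialAverage h τ ^ 2 ≤ radialAverage v τ * ‖h‖ ^ 2 := by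
  obtain ⟨g, hg, hinner⟩ := hv.exists_inner_eq_integral (Ioc_subset_Icc_self hτ) hint
  rw [mul_sq_radialAverage _ hτ.1, radialAverage, mul_assoc, ← hg, ← hinner, ← mul_pow, ← sq_abs]
  gcongr
  · exact (one_div_pos.2 hτ.1).le
  · exact abs_real_inner_le_norm g h

end IsRadialWeight

lemma radialAverage_eq_mul_meanProfile (h : ℝ → ℝ) :
    radialAverage h = fun τ => τ * meanProfile h τ := by
  funext τ
  rcases eq_or_ne τ 0 with rfl | hτ
  · simp [radialAverage]
  have hsubst := intervalIntegral.integral_comp_mul_left (a := 0) (b := 1)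
    (fun s => s * h s) hτ
  simp only [mul_zero, mul_one, mul_assoc, intervalIntegral.integral_const_mul,
    smul_eq_mul] at hsubst
  rw [meanProfile, hsubst, radialAverage, one_div]

lemma radialAverage_congr {h k : ℝ → ℝ} (hhk : h =ᵐ[unitVol] k) {τ : ℝ}
    (hτ : τ ∈ Icc (0 : ℝ) 1) : radialAverage h τ = radialAverage k τ := by
  rw [radialAverage, radialAverage, ← integral_indicator_unitVol hτ,
    ← integral_indicator_unitVol hτ]
  congr 1
  refine integral_congr_ae ?_
  filter_upwards [hhk] with s hs
  simp only [indicator, hs]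

lemma aestronglyMeasurable_radialAverage {h : ℝ → ℝ} (hh : AEStronglyMeasurable h unitVol) :
    AEStronglyMeasurable (radialAverage h) unitVol := by
  have hmk : StronglyMeasurable (radialAverage (hh.mk h)) := by
    rw [radialAverage_eq_mul_meanProfile]
    simp only [meanProfile, intervalIntegral.integral_of_le zero_le_one]
    refine stronglyMeasurable_id.mul (StronglyMeasurable.integral_prod_right ?_)
    exact (measurable_snd.mul (hh.stronglyMeasurable_mk.measurable.comp
      (measurable_fst.mul measurable_snd))).stronglyMeasurable
  refine hmk.aestronglyMeasurable.congr ?_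
  filter_upwards [ae_unitVol_mem] with τ hτ
  exact radialAverage_congr hh.ae_eq_mk.symm (Ioo_subset_Icc_self hτ)

/-- A radial weight `v` for which `∫₀¹ radialAverage v`, the value at the origin of the stream
function of `v`, is finite. It may fail to be integrable at the boundary. -/
structure IsFinitePotentialWeight (v : ℝ → ℝ) : Prop extends IsRadialWeight v where
  intervalIntegrable_mul_weight :
    ∀ τ ∈ Ioo (0 : ℝ) 1, IntervalIntegrable (fun s => s * v s) volume 0 τ
  integrable_radialAverage : Integrable (radialAverage v) unitVol

namespace IsFinitePotentialWeight

variable {v : ℝ → ℝ}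

lemma memLp_radialAverage (hv : IsFinitePotentialWeight v) (h : Lp ℝ 2 (radialMeasure v)) :
    MemLp (radialAverage h) 2 (radialMeasure 1) := by
  have hmeas := aestronglyMeasurable_radialAverage
    (hv.aestronglyMeasurable_iff.1 (Lp.aestronglyMeasurable h))
  rw [isRadialWeight_one.memLp_two_iff hmeas]
  refine (hv.integrable_radialAverage.mul_const (‖h‖ ^ 2)).mono'
    ((measurable_id.div_const 1).aestronglyMeasurable.mul (hmeas.pow 2)) ?_
  filter_upwards [ae_unitVol_mem] with τ hτ
  rw [Pi.one_apply, div_one, Real.norm_of_nonneg (mul_nonneg hτ.1.le (sq_nonneg _))]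
  exact hv.mul_sq_radialAverage_le (Ioo_subset_Ioc_self hτ)
    (hv.intervalIntegrable_mul_weight τ hτ) h

lemma intervalIntegrable_mul_of_mem_Ioo (hv : IsFinitePotentialWeight v)
    (h : Lp ℝ 2 (radialMeasure v)) {τ : ℝ} (hτ : τ ∈ Ioo (0 : ℝ) 1) :
    IntervalIntegrable (fun s => s * h s) volume 0 τ :=
  hv.intervalIntegrable_mul (Ioo_subset_Icc_self hτ) (hv.intervalIntegrable_mul_weight τ hτ)
    (Lp.memLp h)

lemma norm_sq_toLp_radialAverage (hv : IsFinitePotentialWeight v)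
    (h : Lp ℝ 2 (radialMeasure v)) :
    ‖(hv.memLp_radialAverage h).toLp _‖ ^ 2 = ∫ τ, τ * radialAverage h τ ^ 2 ∂unitVol := by
  simp only [isRadialWeight_one.norm_sq_toLp, Pi.one_apply, div_one]

lemma integrable_mul_sq_radialAverage (hv : IsFinitePotentialWeight v)
    (h : Lp ℝ 2 (radialMeasure v)) :
    Integrable (fun τ => τ * radialAverage h τ ^ 2) unitVol := by
  have hmem := hv.memLp_radialAverage h
  simpa only [Pi.one_apply, div_one] using (isRadialWeight_one.memLp_two_iff
    (isRadialWeight_one.aestronglyMeasurable_iff.1 hmem.1)).1 hmem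

lemma norm_toLp_radialAverage_le (hv : IsFinitePotentialWeight v)
    (h : Lp ℝ 2 (radialMeasure v)) :
    ‖(hv.memLp_radialAverage h).toLp _‖ ≤ √(∫ τ, radialAverage v τ ∂unitVol) * ‖h‖ := by
  rw [← Real.sqrt_sq (norm_nonneg h), ← Real.sqrt_mul' _ (sq_nonneg _)]
  refine Real.le_sqrt_of_sq_le ?_
  rw [hv.norm_sq_toLp_radialAverage, ← integral_mul_const]
  refine integral_mono_ae (hv.integrable_mul_sq_radialAverage h)
    (hv.integrable_radialAverage.mul_const _) ?_
  filter_upwards [ae_unitVol_mem] with τ hτ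
  exact hv.mul_sq_radialAverage_le (Ioo_subset_Ioc_self hτ)
    (hv.intervalIntegrable_mul_weight τ hτ) h

/-- The operator `h ↦ radialAverage h` from `L²(s / v(s) ds)` to `L²(s ds)`. Up to sign,
`radialAverage h` is the radial derivative of `radialPotential h`, the stream function of the
vorticity `h`. -/
def velocityOp (hv : IsFinitePotentialWeight v) :
    Lp ℝ 2 (radialMeasure v) →L[ℝ] Lp ℝ 2 (radialMeasure 1) :=
  LinearMap.mkContinuous
    { toFun := fun h => (hv.memLp_radialAverage h).toLp _
      map_add' := fun h k => by
        rw [← MemLp.toLp_add, MemLp.toLp_eq_toLp_iff, Filter.EventuallyEq,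
          isRadialWeight_one.ae_eq]
        filter_upwards [ae_unitVol_mem] with τ hτ
        rw [radialAverage_congr (hv.ae_eq ▸ Lp.coeFn_add h k) (Ioo_subset_Icc_self hτ),
          Pi.add_apply]
        simp only [radialAverage, Pi.add_apply, mul_add]
        rw [intervalIntegral.integral_add (hv.intervalIntegrable_mul_of_mem_Ioo h hτ)
          (hv.intervalIntegrable_mul_of_mem_Ioo k hτ), mul_add]
      map_smul' := fun c h => by
        rw [RingHom.id_apply, ← MemLp.toLp_const_smul, MemLp.toLp_eq_toLp_iff,
          Filter.EventuallyEq, isRadialWeight_one.ae_eq]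
        filter_upwards [ae_unitVol_mem] with τ hτ
        rw [radialAverage_congr (hv.ae_eq ▸ Lp.coeFn_smul c h) (Ioo_subset_Icc_self hτ),
          Pi.smul_apply, smul_eq_mul]
        simp only [radialAverage, Pi.smul_apply, smul_eq_mul, mul_left_comm _ c,
          intervalIntegral.integral_const_mul] }
    (√(∫ τ, radialAverage v τ ∂unitVol)) hv.norm_toLp_radialAverage_le

lemma velocityOp_ae_eq (hv : IsFinitePotentialWeight v) (h : Lp ℝ 2 (radialMeasure v)) :
    hv.velocityOp h =ᵐ[unitVol] radialAverage h :=
  isRadialWeight_one.ae_eq_toLp (hv.memLp_radialAverage h)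

lemma inner_velocityOp (hv : IsFinitePotentialWeight v) (h k : Lp ℝ 2 (radialMeasure v)) :
    inner ℝ (hv.velocityOp h) (hv.velocityOp k)
      = ∫ τ, τ * (radialAverage h τ * radialAverage k τ) ∂unitVol := by
  simp only [isRadialWeight_one.inner_eq (hv.velocityOp_ae_eq h) (hv.velocityOp_ae_eq k),
    Pi.one_apply, div_one]

lemma hilbertSchmidtSqLE_velocityOp (hv : IsFinitePotentialWeight v) :
    HilbertSchmidtSqLE hv.velocityOp (∫ τ, radialAverage v τ ∂unitVol) := by
  intro n e he
  calc ∑ i, ‖hv.velocityOp (e i)‖ ^ 2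
      = ∫ τ, ∑ i, τ * radialAverage (e i) τ ^ 2 ∂unitVol := by
        rw [integral_finsetSum _ fun i _ => hv.integrable_mul_sq_radialAverage (e i)]
        exact Finset.sum_congr rfl fun i _ => hv.norm_sq_toLp_radialAverage (e i)
    _ ≤ ∫ τ, radialAverage v τ ∂unitVol := by
        refine integral_mono_ae (integrable_finsetSum _ fun i _ =>
          hv.integrable_mul_sq_radialAverage (e i)) hv.integrable_radialAverage ?_
        filter_upwards [ae_unitVol_mem] with τ hτ
        exact hv.sum_mul_sq_radialAverage_le (Ioo_subset_Ioc_self hτ)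
          (hv.intervalIntegrable_mul_weight τ hτ) he

end IsFinitePotentialWeight

lemma integrable_neg_log_one_sub : Integrable (fun τ : ℝ => -Real.log (1 - τ)) unitVol := by
  have hlog := ((intervalIntegral.intervalIntegrable_log' (a := 0) (b := 1)).comp_sub_left 1).symm
  simp only [sub_self, sub_zero] at hlog
  exact integrable_unitVol_iff.2 hlog.neg

lemma intervalIntegrable_inv_one_sub {τ : ℝ} (hτ : τ ∈ Ioo (0 : ℝ) 1) :
    IntervalIntegrable (fun s : ℝ => (1 - s)⁻¹) volume 0 τ := by
  refine ContinuousOn.intervalIntegrable (ContinuousOn.inv₀ (by fun_prop) fun s hs => ?_)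
  rw [uIcc_of_le hτ.1.le] at hs
  linarith [hs.2, hτ.2]

lemma integral_inv_one_sub {τ : ℝ} (hτ : τ ∈ Ioo (0 : ℝ) 1) :
    ∫ s in (0 : ℝ)..τ, (1 - s)⁻¹ = -Real.log (1 - τ) := by
  rw [intervalIntegral.integral_comp_sub_left (fun x : ℝ => x⁻¹) 1, sub_zero,
    integral_inv_of_pos (by linarith [hτ.2]) one_pos, one_div, Real.log_inv]

namespace IsRadialWeight

variable {v : ℝ → ℝ} {C : ℝ}

lemma intervalIntegrable_mul_of_le_div (hv : IsRadialWeight v)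
    (hle : ∀ s ∈ Ioo (0 : ℝ) 1, v s ≤ C / (1 - s)) {τ : ℝ} (hτ : τ ∈ Ioo (0 : ℝ) 1) :
    IntervalIntegrable (fun s => s * v s) volume 0 τ := by
  have hmeas : AEStronglyMeasurable (fun s => s * v s) unitVol :=
    (aemeasurable_id.mul hv.aemeasurable).aestronglyMeasurable
  refine ((intervalIntegrable_inv_one_sub hτ).const_mul C).mono_fun' ?_ ?_
  all_goals rw [uIoc_of_le hτ.1.le, ← Measure.restrict_congr_set Ioo_ae_eq_Ioc]
  · exact hmeas.mono_measure (Measure.restrict_mono (Ioo_subset_Ioo_right hτ.2.le) le_rfl)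
  · filter_upwards [ae_restrict_mem measurableSet_Ioo] with s hs
    have hs' : s ∈ Ioo (0 : ℝ) 1 := ⟨hs.1, hs.2.trans hτ.2⟩
    have hvs := hv.pos s hs'
    rw [Real.norm_of_nonneg (mul_pos hs.1 hvs).le, ← div_eq_mul_inv]
    exact (mul_le_of_le_one_left hvs.le hs'.2.le).trans (hle s hs')

lemma radialAverage_le_of_le_div (hv : IsRadialWeight v)
    (hle : ∀ s ∈ Ioo (0 : ℝ) 1, v s ≤ C / (1 - s)) {τ : ℝ} (hτ : τ ∈ Ioo (0 : ℝ) 1) :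
    radialAverage v τ ≤ C * -Real.log (1 - τ) := by
  rw [radialAverage, one_div, inv_mul_le_iff₀ hτ.1, ← integral_inv_one_sub hτ,
    ← intervalIntegral.integral_const_mul, ← intervalIntegral.integral_const_mul]
  refine intervalIntegral.integral_mono_on_of_le_Ioo hτ.1.le
    (hv.intervalIntegrable_mul_of_le_div hle hτ)
    (((intervalIntegrable_inv_one_sub hτ).const_mul C).const_mul τ) fun s hs => ?_
  have hs' : s ∈ Ioo (0 : ℝ) 1 := ⟨hs.1, hs.2.trans hτ.2⟩
  rw [← div_eq_mul_inv]
  exact mul_le_mul hs.2.le (hle s hs') (hv.pos s hs').le hτ.1.le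

lemma radialAverage_nonneg (hv : IsRadialWeight v) {τ : ℝ} (hτ : τ ∈ Icc (0 : ℝ) 1) :
    0 ≤ radialAverage v τ := by
  rw [radialAverage, ← integral_indicator_unitVol hτ]
  refine mul_nonneg (one_div_nonneg.2 hτ.1) (integral_nonneg_of_ae ?_)
  filter_upwards [ae_unitVol_mem] with s hs
  rw [Pi.zero_apply, indicator]
  split_ifs
  exacts [(mul_pos hs.1 (hv.pos s hs)).le, le_rfl]

lemma isFinitePotentialWeight_of_le_div (hv : IsRadialWeight v)
    (hle : ∀ s ∈ Ioo (0 : ℝ) 1, v s ≤ C / (1 - s)) : IsFinitePotentialWeight v where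
  toIsRadialWeight := hv
  intervalIntegrable_mul_weight _ hτ := hv.intervalIntegrable_mul_of_le_div hle hτ
  integrable_radialAverage := by
    refine (integrable_neg_log_one_sub.const_mul C).mono'
      (aestronglyMeasurable_radialAverage hv.aemeasurable.aestronglyMeasurable) ?_
    filter_upwards [ae_unitVol_mem] with τ hτ
    rw [Real.norm_of_nonneg (hv.radialAverage_nonneg (Ioo_subset_Icc_self hτ))]
    exact hv.radialAverage_le_of_le_div hle hτ

end IsRadialWeight

end Velocity

section Potential

lemma radialPotential_congr {h k : ℝ → ℝ} (hhk : h =ᵐ[unitVol] k) {r : ℝ}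
    (hr : r ∈ Icc (0 : ℝ) 1) : radialPotential h r = radialPotential k r := by
  refine intervalIntegral.integral_congr fun τ hτ => ?_
  rw [uIcc_of_le hr.2] at hτ
  exact radialAverage_congr hhk ⟨hr.1.trans hτ.1, hτ.2⟩

/-- A radial weight bounded by `C`. -/
structure IsBoundedWeight (v : ℝ → ℝ) (C : ℝ) : Prop extends IsRadialWeight v where
  le_const : ∀ s ∈ Ioo (0 : ℝ) 1, v s ≤ C

namespace IsBoundedWeight

variable {v : ℝ → ℝ} {C : ℝ}

lemma const_pos (hv : IsBoundedWeight v C) : 0 < C :=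
  have hmem : (1 / 2 : ℝ) ∈ Ioo (0 : ℝ) 1 := by constructor <;> norm_num
  (hv.pos _ hmem).trans_le (hv.le_const _ hmem)

lemma isFinitePotentialWeight (hv : IsBoundedWeight v C) : IsFinitePotentialWeight v :=
  hv.isFinitePotentialWeight_of_le_div (C := C) fun s hs => (hv.le_const s hs).trans <|
    le_div_self hv.const_pos.le (sub_pos.2 hs.2) (sub_le_self 1 hs.1.le)

lemma mul_weight_le (hv : IsBoundedWeight v C) {s : ℝ} (hs : s ∈ Ioo (0 : ℝ) 1) : s * v s ≤ C :=
  (mul_le_of_le_one_left (hv.pos s hs).le hs.2.le).trans (hv.le_const s hs)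

lemma intervalIntegrable_mul_weight (hv : IsBoundedWeight v C) :
    IntervalIntegrable (fun s => s * v s) volume 0 1 := by
  refine integrable_unitVol_iff.1 ((integrable_const C).mono'
    (aemeasurable_id.mul hv.aemeasurable).aestronglyMeasurable ?_)
  filter_upwards [ae_unitVol_mem] with s hs
  rw [Real.norm_of_nonneg (mul_pos hs.1 (hv.pos s hs)).le]
  exact hv.mul_weight_le hs

lemma radialAverage_weight_le (hv : IsBoundedWeight v C) {τ : ℝ} (hτ : τ ∈ Ioo (0 : ℝ) 1) :
    radialAverage v τ ≤ τ * C := by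
  calc radialAverage v τ ≤ 1 / τ * ∫ _s in (0 : ℝ)..τ, τ * C := by
        refine mul_le_mul_of_nonneg_left ?_ (one_div_pos.2 hτ.1).le
        refine intervalIntegral.integral_mono_on_of_le_Ioo hτ.1.le
          (hv.isFinitePotentialWeight.intervalIntegrable_mul_weight τ hτ) (by simp) fun s hs => ?_
        have hs' : s ∈ Ioo (0 : ℝ) 1 := ⟨hs.1, hs.2.trans hτ.2⟩
        exact mul_le_mul hs.2.le (hv.le_const s hs') (hv.pos s hs').le hτ.1.le
    _ = τ * C := by
        have hτ0 := hτ.1.ne'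
        rw [intervalIntegral.integral_const, smul_eq_mul]
        field_simp
        ring

lemma intervalIntegrable_mul (hv : IsBoundedWeight v C) (h : Lp ℝ 2 (radialMeasure v)) :
    IntervalIntegrable (fun s => s * h s) volume 0 1 :=
  hv.toIsRadialWeight.intervalIntegrable_mul (right_mem_Icc.2 zero_le_one)
    hv.intervalIntegrable_mul_weight (Lp.memLp h)

lemma abs_radialAverage_le (hv : IsBoundedWeight v C) (h : Lp ℝ 2 (radialMeasure v)) {τ : ℝ}
    (hτ : τ ∈ Ioo (0 : ℝ) 1) : |radialAverage h τ| ≤ √C * ‖h‖ := by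
  refine abs_le_of_sq_le_sq ?_ (by positivity)
  rw [mul_pow, Real.sq_sqrt hv.const_pos.le]
  refine le_of_mul_le_mul_left ?_ hτ.1
  calc τ * radialAverage h τ ^ 2 ≤ radialAverage v τ * ‖h‖ ^ 2 :=
        hv.mul_sq_radialAverage_le (Ioo_subset_Ioc_self hτ)
          (hv.isFinitePotentialWeight.intervalIntegrable_mul_weight τ hτ) h
    _ ≤ τ * C * ‖h‖ ^ 2 :=
        mul_le_mul_of_nonneg_right (hv.radialAverage_weight_le hτ) (sq_nonneg _)
    _ = τ * (C * ‖h‖ ^ 2) := mul_assoc _ _ _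

lemma intervalIntegrable_radialAverage (hv : IsBoundedWeight v C)
    (h : Lp ℝ 2 (radialMeasure v)) : IntervalIntegrable (radialAverage h) volume 0 1 := by
  refine integrable_unitVol_iff.1 ((integrable_const (√C * ‖h‖)).mono'
    (aestronglyMeasurable_radialAverage
      (hv.aestronglyMeasurable_iff.1 (Lp.aestronglyMeasurable h))) ?_)
  filter_upwards [ae_unitVol_mem] with τ hτ
  exact hv.abs_radialAverage_le h hτ

lemma continuousOn_radialPotential (hv : IsBoundedWeight v C) (h : Lp ℝ 2 (radialMeasure v)) :
    ContinuousOn (radialPotential h) (Icc 0 1) := by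
  have hprim := intervalIntegral.continuousOn_primitive_interval'
    (hv.intervalIntegrable_radialAverage h) right_mem_uIcc
  rw [uIcc_of_le zero_le_one] at hprim
  exact hprim.neg.congr fun r _ => intervalIntegral.integral_symm _ _

lemma inner_velocityOp (hv : IsBoundedWeight v C) (h k : Lp ℝ 2 (radialMeasure v)) :
    inner ℝ (hv.isFinitePotentialWeight.velocityOp h) (hv.isFinitePotentialWeight.velocityOp k)
      = ∫ s, s * k s * radialPotential h s ∂unitVol := by
  calc inner ℝ (hv.isFinitePotentialWeight.velocityOp h)
        (hv.isFinitePotentialWeight.velocityOp k)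
      = ∫ τ in (0 : ℝ)..1, radialAverage h τ * ∫ s in (0 : ℝ)..τ, s * k s := by
        rw [IsFinitePotentialWeight.inner_velocityOp, ← integral_unitVol]
        refine integral_congr_ae ?_
        filter_upwards [ae_unitVol_mem] with τ hτ
        have hτ0 := hτ.1.ne'
        simp only [radialAverage]
        field_simp
    _ = ∫ s in (0 : ℝ)..1, s * k s * radialPotential h s :=
        (integral_mul_integral_swap (hv.intervalIntegrable_radialAverage h)
          (hv.intervalIntegrable_mul k)).symm
    _ = ∫ s, s * k s * radialPotential h s ∂unitVol := (integral_unitVol _).symm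

lemma memLp_mul_radialPotential (hv : IsBoundedWeight v C) (h : Lp ℝ 2 (radialMeasure v)) :
    MemLp (fun r => v r * radialPotential h r) 2 (radialMeasure v) := by
  have hcont := hv.continuousOn_radialPotential h
  have hmeas : AEStronglyMeasurable (fun r => v r * radialPotential h r) unitVol :=
    hv.aemeasurable.aestronglyMeasurable.mul
      ((hcont.mono Ioo_subset_Icc_self).aestronglyMeasurable measurableSet_Ioo)
  obtain ⟨B, hB⟩ := isCompact_Icc.exists_bound_of_continuousOn hcont
  rw [hv.memLp_two_iff hmeas]
  refine (integrable_const (C * B ^ 2)).mono'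
    ((aemeasurable_id.div hv.aemeasurable).aestronglyMeasurable.mul (hmeas.pow 2)) ?_
  filter_upwards [ae_unitVol_mem] with s hs
  have hvs := hv.pos s hs
  calc ‖s / v s * (v s * radialPotential h s) ^ 2‖ = s * v s * ‖radialPotential h s‖ ^ 2 := by
        rw [Real.norm_eq_abs, abs_of_nonneg (mul_nonneg (div_pos hs.1 hvs).le (sq_nonneg _)),
          Real.norm_eq_abs, sq_abs]
        field_simp
    _ ≤ C * B ^ 2 := by
        have hC := hv.const_pos.le
        gcongr
        exacts [hv.mul_weight_le hs, hB s (Ioo_subset_Icc_self hs)]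

/-- The operator `h ↦ v · radialPotential h`, in factorized form; for `v = ν_Ω` it is `𝓛₀^Ω`. -/
def potentialOp (hv : IsBoundedWeight v C) :
    Lp ℝ 2 (radialMeasure v) →L[ℝ] Lp ℝ 2 (radialMeasure v) :=
  ContinuousLinearMap.adjoint hv.isFinitePotentialWeight.velocityOp ∘L
    hv.isFinitePotentialWeight.velocityOp

lemma potentialOp_eq_toLp (hv : IsBoundedWeight v C) (h : Lp ℝ 2 (radialMeasure v)) :
    hv.potentialOp h = (hv.memLp_mul_radialPotential h).toLp _ := by
  refine ext_inner_right ℝ fun k => ?_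
  rw [potentialOp, ContinuousLinearMap.comp_apply, ContinuousLinearMap.adjoint_inner_left,
    hv.inner_velocityOp, hv.inner_eq (hv.ae_eq_toLp _) .rfl]
  refine integral_congr_ae ?_
  filter_upwards [ae_unitVol_mem] with s hs
  have hvs := (hv.pos s hs).ne'
  field_simp

lemma potentialOp_ae_eq (hv : IsBoundedWeight v C) (h : Lp ℝ 2 (radialMeasure v)) :
    hv.potentialOp h =ᵐ[unitVol] fun r => v r * radialPotential h r :=
  hv.potentialOp_eq_toLp h ▸ hv.ae_eq_toLp _

lemma isSelfAdjoint_potentialOp (hv : IsBoundedWeight v C) : IsSelfAdjoint hv.potentialOp :=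
  (ContinuousLinearMap.isPositive_adjoint_comp_self _).isSelfAdjoint

lemma isHilbertSchmidt_potentialOp (hv : IsBoundedWeight v C) :
    IsHilbertSchmidt hv.potentialOp :=
  hv.isFinitePotentialWeight.hilbertSchmidtSqLE_velocityOp.isHilbertSchmidt_comp _

lemma velocityOp_eq_zero_iff (hv : IsBoundedWeight v C) {h : Lp ℝ 2 (radialMeasure v)} :
    hv.isFinitePotentialWeight.velocityOp h = 0 ↔ h = 0 := by
  refine ⟨fun h0 => ?_, fun h0 => by rw [h0, map_zero]⟩
  have hprim : ∀ᵐ τ ∂unitVol, ∫ s in (0 : ℝ)..τ, s * h s = 0 := by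
    filter_upwards [(isRadialWeight_one.toLp_eq_zero_iff
      (hv.isFinitePotentialWeight.memLp_radialAverage h)).1 h0, ae_unitVol_mem] with τ hτ hτm
    simpa only [radialAverage, Pi.zero_apply, mul_eq_zero, one_div, inv_eq_zero, hτm.1.ne',
      false_or] using hτ
  rw [Lp.eq_zero_iff_ae_eq_zero, Filter.EventuallyEq, hv.ae_eq]
  filter_upwards [ae_eq_zero_of_integral_ae_eq_zero zero_le_one (hv.intervalIntegrable_mul h) hprim,
    ae_unitVol_mem] with s hs hsm
  exact (mul_eq_zero.1 hs).resolve_left hsm.1.ne'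

lemma inner_potentialOp_self_pos (hv : IsBoundedWeight v C) {h : Lp ℝ 2 (radialMeasure v)}
    (hh : h ≠ 0) : 0 < inner ℝ (hv.potentialOp h) h := by
  rw [potentialOp, ContinuousLinearMap.comp_apply, ContinuousLinearMap.adjoint_inner_left,
    real_inner_self_eq_norm_sq]
  exact pow_pos (norm_pos_iff.2 (hv.velocityOp_eq_zero_iff.not.2 hh)) 2

lemma eq_zero_of_mul_radialPotential_eq_neg (hv : IsBoundedWeight v C)
    {h : Lp ℝ 2 (radialMeasure v)} (hh : ∀ᵐ s ∂unitVol, v s * radialPotential h s = -h s) :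
    h = 0 := by
  have hneg : hv.potentialOp h = -h := by
    have hcoe : ⇑(-h) =ᵐ[unitVol] -h := hv.ae_eq ▸ Lp.coeFn_neg h
    refine Lp.ext (hv.ae_eq ▸ ?_)
    filter_upwards [hv.potentialOp_ae_eq h, hcoe, hh] with s hT hs hs'
    rw [hT, hs, hs', Pi.neg_apply]
  by_contra hne
  have hpos := hv.inner_potentialOp_self_pos hne
  rw [hneg, inner_neg_left, real_inner_self_eq_norm_sq] at hpos
  linarith [sq_nonneg ‖h‖]

end IsBoundedWeight

end Potential

section Embedding

variable {v w : ℝ → ℝ} {c C : ℝ}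

/-- The inclusion of `L²(s / w(s) ds)` in `L²(s / v(s) ds)`, for `w ≤ c v`. -/
def weightEmbedding (hw : IsRadialWeight w) (hv : IsRadialWeight v)
    (hle : ∀ s ∈ Ioo (0 : ℝ) 1, w s ≤ c * v s) :
    Lp ℝ 2 (radialMeasure w) →L[ℝ] Lp ℝ 2 (radialMeasure v) :=
  Lp.LpToLpOfMeasureLeSMul ENNReal.ofReal_ne_top (radialMeasure_le_smul hw hv hle)

lemma weightEmbedding_ae_eq (hw : IsRadialWeight w) (hv : IsRadialWeight v)
    (hle : ∀ s ∈ Ioo (0 : ℝ) 1, w s ≤ c * v s) (h : Lp ℝ 2 (radialMeasure w)) :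
    weightEmbedding hw hv hle h =ᵐ[unitVol] h :=
  hv.ae_eq ▸ Lp.coeFn_LpToLpOfMeasureLeSMul _ _ h

lemma velocityOp_weightEmbedding (hw : IsFinitePotentialWeight w) (hv : IsFinitePotentialWeight v)
    (hle : ∀ s ∈ Ioo (0 : ℝ) 1, w s ≤ c * v s) (h : Lp ℝ 2 (radialMeasure w)) :
    hv.velocityOp (weightEmbedding hw.toIsRadialWeight hv.toIsRadialWeight hle h)
      = hw.velocityOp h := by
  refine Lp.ext ?_
  rw [isRadialWeight_one.ae_eq]
  filter_upwards [hv.velocityOp_ae_eq (weightEmbedding _ _ hle h), hw.velocityOp_ae_eq h,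
    ae_unitVol_mem] with τ hτv hτw hτ
  rw [hτv, hτw]
  exact radialAverage_congr (weightEmbedding_ae_eq _ _ _ h) (Ioo_subset_Icc_self hτ)

/-- The operator on `L²(s / w(s) ds)` with quadratic form
`h ↦ ‖radialAverage h‖² - ∫₀¹ s h(s)² / v(s) ds`, for `w ≤ c v`. -/
def shiftedPotentialOp (hw : IsBoundedWeight w C) (hv : IsRadialWeight v)
    (hle : ∀ s ∈ Ioo (0 : ℝ) 1, w s ≤ c * v s) :
    Lp ℝ 2 (radialMeasure w) →L[ℝ] Lp ℝ 2 (radialMeasure w) :=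
  hw.potentialOp - ContinuousLinearMap.adjoint (weightEmbedding hw.toIsRadialWeight hv hle) ∘L
    weightEmbedding hw.toIsRadialWeight hv hle

lemma inner_shiftedPotentialOp (hw : IsBoundedWeight w C) (hv : IsRadialWeight v)
    (hle : ∀ s ∈ Ioo (0 : ℝ) 1, w s ≤ c * v s) (h k : Lp ℝ 2 (radialMeasure w)) :
    inner ℝ (shiftedPotentialOp hw hv hle h) k = inner ℝ (hw.potentialOp h) k
      - inner ℝ (weightEmbedding hw.toIsRadialWeight hv hle h)
        (weightEmbedding hw.toIsRadialWeight hv hle k) := by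
  rw [shiftedPotentialOp, sub_apply, inner_sub_left,
    ContinuousLinearMap.comp_apply, ContinuousLinearMap.adjoint_inner_left]

lemma isSymmetric_shiftedPotentialOp (hw : IsBoundedWeight w C) (hv : IsRadialWeight v)
    (hle : ∀ s ∈ Ioo (0 : ℝ) 1, w s ≤ c * v s) :
    LinearMap.IsSymmetric (shiftedPotentialOp hw hv hle).toLinearMap :=
  (hw.isSelfAdjoint_potentialOp.sub
    (ContinuousLinearMap.isPositive_adjoint_comp_self _).isSelfAdjoint).isSymmetric

lemma shiftedPotentialOp_eq_smul (hw : IsBoundedWeight w C) (hv : IsRadialWeight v)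
    (hle : ∀ s ∈ Ioo (0 : ℝ) 1, w s ≤ c * v s) {l : ℝ} {h : Lp ℝ 2 (radialMeasure w)}
    (hh : ∀ᵐ s ∂unitVol, radialPotential h s = (l / w s + 1 / v s) * h s) :
    shiftedPotentialOp hw hv hle h = l • h := by
  refine ext_inner_right ℝ fun k => ?_
  let ι := weightEmbedding hw.toIsRadialWeight hv hle
  have hι : ∀ x, ι x =ᵐ[unitVol] x := weightEmbedding_ae_eq _ _ _
  have hint : Integrable (fun s => l * (s / w s * (h s * k s))) unitVol :=
    (hw.integrable_iff.1 ((Lp.memLp h).integrable_mul (Lp.memLp k))).const_mul l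
  have hint' : Integrable (fun s => s / v s * (h s * k s)) unitVol := by
    refine (hv.integrable_iff.1 ((Lp.memLp (ι h)).integrable_mul (Lp.memLp (ι k)))).congr ?_
    filter_upwards [hι h, hι k] with s hs hs'
    rw [Pi.mul_apply, hs, hs']
  rw [inner_shiftedPotentialOp, real_inner_smul_left, sub_eq_iff_eq_add,
    hw.inner_eq (hw.potentialOp_ae_eq h) .rfl, hw.inner_eq (f := h) .rfl .rfl,
    hv.inner_eq (hι h) (hι k), ← integral_const_mul, ← integral_add hint hint']
  refine integral_congr_ae ?_
  filter_upwards [hh, ae_unitVol_mem] with s hs hsm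
  have hws := (hw.pos s hsm).ne'
  have hvs := (hv.pos s hsm).ne'
  rw [hs]
  field_simp

lemma finite_setOf_radialPotential_eq (hw : IsBoundedWeight w C) (hv : IsFinitePotentialWeight v)
    (hle : ∀ s ∈ Ioo (0 : ℝ) 1, w s ≤ c * v s) :
    {l : ℝ | 0 < l ∧ ∃ h : Lp ℝ 2 (radialMeasure w), h ≠ 0 ∧
      ∀ᵐ s ∂unitVol, radialPotential h s = (l / w s + 1 / v s) * h s}.Finite := by
  refine (hv.hilbertSchmidtSqLE_velocityOp.finite_setOf_hasEigenvalue
    (weightEmbedding hw.toIsRadialWeight hv.toIsRadialWeight hle)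
    (isSymmetric_shiftedPotentialOp hw hv.toIsRadialWeight hle) fun h => ?_).subset ?_
  · rw [velocityOp_weightEmbedding hw.isFinitePotentialWeight, ← real_inner_self_eq_norm_sq,
      ← real_inner_self_eq_norm_sq, ← ContinuousLinearMap.adjoint_inner_left]
    exact inner_shiftedPotentialOp hw hv.toIsRadialWeight hle h h
  · rintro l ⟨hl, h, hne, hh⟩
    exact ⟨hl, Module.End.hasEigenvalue_of_hasEigenvector
      (Module.End.hasEigenvector_iff.2 ⟨Module.End.mem_eigenspace_iff.2
        (shiftedPotentialOp_eq_smul hw hv.toIsRadialWeight hle hh), hne⟩)⟩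

end Embedding

section Profile

/-- A continuous profile lying between two parabolas: `c ≤ f₀'(r) / r ≤ W` in the interior, with
`c > 0`. -/
structure IsQuadraticProfile (f₀ : ℝ → ℝ) (c W : ℝ) : Prop where
  continuousOn : ContinuousOn f₀ (Icc 0 1)
  const_pos : 0 < c
  const_le : ∀ r ∈ Ioo (0 : ℝ) 1, c ≤ derivOverR f₀ r
  le_const : ∀ r ∈ Ioo (0 : ℝ) 1, derivOverR f₀ r ≤ W

lemma derivOverR_eq_div {f₀ : ℝ → ℝ} {r : ℝ} (hr : 0 < r) :
    derivOverR f₀ r = profileDeriv f₀ r / r :=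
  if_neg hr.ne'

namespace SmoothProfile

variable {β : ℝ≥0} {f₀ : ℝ → ℝ}

lemma continuousOn (hf : SmoothProfile β f₀) : ContinuousOn f₀ (Icc 0 1) := by
  obtain ⟨g, ⟨hg, -⟩, hfg⟩ := hf
  exact (hg.continuousOn.comp (by fun_prop) fun r hr =>
    ⟨sq_nonneg r, pow_le_one₀ hr.1 hr.2⟩).congr hfg

lemma exists_derivOverR_le (hf : SmoothProfile β f₀) :
    ∃ W, ∀ r ∈ Ioo (0 : ℝ) 1, derivOverR f₀ r ≤ W := by
  obtain ⟨g, ⟨hg, -⟩, hfg⟩ := hf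
  have hu : UniqueDiffOn ℝ (Icc (0 : ℝ) 1) := uniqueDiffOn_Icc zero_lt_one
  have hmaps : MapsTo (fun r : ℝ => r ^ 2) (Icc 0 1) (Icc 0 1) := fun r hr =>
    ⟨sq_nonneg r, pow_le_one₀ hr.1 hr.2⟩
  obtain ⟨M, hM⟩ := isCompact_Icc.exists_bound_of_continuousOn
    (hg.continuousOn_derivWithin hu (by norm_num))
  refine ⟨2 * M, fun r hr => ?_⟩
  have hr' := Ioo_subset_Icc_self hr
  have hderiv : profileDeriv f₀ r = derivWithin g (Icc 0 1) (r ^ 2) * (2 * r) := by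
    have hg' := (hg.differentiableOn (by norm_num) _ (hmaps hr')).hasDerivWithinAt
    have hsq : HasDerivWithinAt (fun r : ℝ => r ^ 2) (2 * r) (Icc 0 1) r := by
      simpa using (hasDerivAt_pow 2 r).hasDerivWithinAt
    exact ((hg'.comp (h := fun r : ℝ => r ^ 2) r hsq hmaps).congr hfg (hfg r hr')).derivWithin
      (hu r hr')
  rw [derivOverR_eq_div hr.1, hderiv, ← mul_assoc, mul_div_cancel_right₀ _ hr.1.ne', mul_comm]
  exact mul_le_mul_of_nonneg_left ((le_abs_self _).trans (hM _ (hmaps hr'))) zero_le_two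

lemma exists_isQuadraticProfile (hf : SmoothProfile β f₀) (hf' : MonotoneProfile f₀) :
    ∃ c W, IsQuadraticProfile f₀ c W := by
  obtain ⟨W, hW⟩ := hf.exists_derivOverR_le
  have hbdd : BddBelow ((fun r => profileDeriv f₀ r / r) '' Ioc 0 1) :=
    not_imp_comm.1 Real.sInf_of_not_bddBelow hf'.ne'
  refine ⟨_, W, hf.continuousOn, hf', fun r hr => ?_, hW⟩
  rw [derivOverR_eq_div hr.1]
  exact csInf_le hbdd (mem_image_of_mem _ (Ioo_subset_Ioc_self hr))

end SmoothProfile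

namespace IsQuadraticProfile

variable {f₀ : ℝ → ℝ} {c W Ω r : ℝ}

lemma derivOverR_pos (hf : IsQuadraticProfile f₀ c W) (hr : r ∈ Ioo (0 : ℝ) 1) :
    0 < derivOverR f₀ r :=
  hf.const_pos.trans_le (hf.const_le r hr)

lemma hasDerivAt (hf : IsQuadraticProfile f₀ c W) (hr : r ∈ Ioo (0 : ℝ) 1) :
    HasDerivAt f₀ (r * derivOverR f₀ r) r := by
  have heq : r * derivOverR f₀ r = profileDeriv f₀ r := by
    rw [derivOverR_eq_div hr.1, mul_div_cancel₀ _ hr.1.ne']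
  have hne : profileDeriv f₀ r ≠ 0 := heq ▸ (mul_pos hr.1 (hf.derivOverR_pos hr)).ne'
  rw [heq]
  exact (differentiableWithinAt_of_derivWithin_ne_zero hne).hasDerivWithinAt.hasDerivAt
    (Icc_mem_nhds hr.1 hr.2)

lemma isBoundedWeight_derivOverR (hf : IsQuadraticProfile f₀ c W) :
    IsBoundedWeight (derivOverR f₀) W := by
  refine ⟨⟨?_, fun s hs => hf.derivOverR_pos hs⟩, hf.le_const⟩
  refine ((measurable_deriv f₀).div measurable_id).aemeasurable.congr ?_
  filter_upwards [ae_unitVol_mem] with s hs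
  rw [Pi.div_apply, id, (hf.hasDerivAt hs).deriv, mul_div_cancel_left₀ _ hs.1.ne']

lemma intervalIntegrable_mul_comp (hf : IsQuadraticProfile f₀ c W) (hr : r ∈ Icc (0 : ℝ) 1) :
    IntervalIntegrable (fun s => s * f₀ (r * s)) volume 0 1 := by
  refine ContinuousOn.intervalIntegrable_of_Icc zero_le_one (continuousOn_id.mul
    (hf.continuousOn.comp (by fun_prop) fun s hs => ?_))
  exact ⟨mul_nonneg hr.1 hs.1, mul_le_one₀ hr.2 hs.1 hs.2⟩

lemma continuousOn_meanProfile (hf : IsQuadraticProfile f₀ c W) :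
    ContinuousOn (meanProfile f₀) (Icc 0 1) := by
  let F := IccExtend (zero_le_one' ℝ) ((Icc 0 1).domRestrict f₀)
  have hF : Continuous F :=
    (continuousOn_iff_continuous_domRestrict.1 hf.continuousOn).Icc_extend'
  have hmean : Continuous fun r : ℝ => ∫ s in (0 : ℝ)..1, s * F (r * s) :=
    intervalIntegral.continuous_parametric_intervalIntegral_of_continuous' (by fun_prop) 0 1
  refine hmean.continuousOn.congr fun r hr => intervalIntegral.integral_congr fun s hs => ?_
  rw [uIcc_of_le zero_le_one] at hs
  have hrs : r * s ∈ Icc (0 : ℝ) 1 := ⟨mul_nonneg hr.1 hs.1, mul_le_one₀ hr.2 hs.1 hs.2⟩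
  simp only [F, IccExtend_of_mem _ _ hrs, domRestrict_apply]

lemma aemeasurable_meanProfile (hf : IsQuadraticProfile f₀ c W) :
    AEMeasurable (meanProfile f₀) unitVol :=
  (hf.continuousOn_meanProfile.mono Ioo_subset_Icc_self).aemeasurable measurableSet_Ioo

lemma kappa₁_le_meanProfile (hf : IsQuadraticProfile f₀ c W) (hr : r ∈ Icc (0 : ℝ) 1) :
    kappa₁ f₀ ≤ meanProfile f₀ r :=
  csInf_le (isCompact_Icc.image_of_continuousOn hf.continuousOn_meanProfile).bddBelow
    (mem_image_of_mem _ hr)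

lemma meanProfile_le_kappa₂ (hf : IsQuadraticProfile f₀ c W) (hr : r ∈ Icc (0 : ℝ) 1) :
    meanProfile f₀ r ≤ kappa₂ f₀ :=
  le_csSup (isCompact_Icc.image_of_continuousOn hf.continuousOn_meanProfile).bddAbove
    (mem_image_of_mem _ hr)

lemma mul_sq_sub_sq_le (hf : IsQuadraticProfile f₀ c W) {x y : ℝ} (hx : 0 ≤ x) (hxy : x ≤ y)
    (hy : y ≤ 1) : c / 2 * (y ^ 2 - x ^ 2) ≤ f₀ y - f₀ x := by
  have hmono : MonotoneOn (fun r => f₀ r - c / 2 * r ^ 2) (Icc 0 1) := by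
    refine monotoneOn_of_hasDerivWithinAt_nonneg
      (f' := fun r => r * derivOverR f₀ r - c / 2 * (2 * r))
      (convex_Icc 0 1) (hf.continuousOn.sub (by fun_prop)) ?_ ?_ <;> rw [interior_Icc]
    · intro r hr
      have hsq : HasDerivAt (fun r : ℝ => c / 2 * r ^ 2) (c / 2 * (2 * r)) r := by
        simpa using (hasDerivAt_pow 2 r).const_mul (c / 2)
      exact ((hf.hasDerivAt hr).sub hsq).hasDerivWithinAt
    · intro r hr
      nlinarith [hf.const_le r hr, hr.1]
  have := hmono ⟨hx, hxy.trans hy⟩ ⟨hx.trans hxy, hy⟩ hxy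
  simp only at this
  linarith

lemma mul_one_sub_le_kappa₂_sub_meanProfile (hf : IsQuadraticProfile f₀ c W)
    (hr : r ∈ Icc (0 : ℝ) 1) : c / 8 * (1 - r) ≤ kappa₂ f₀ - meanProfile f₀ r := by
  have h1 : (1 : ℝ) ∈ Icc (0 : ℝ) 1 := right_mem_Icc.2 zero_le_one
  have hint : ∫ s in (0 : ℝ)..1, c / 2 * (1 - r ^ 2) * s ^ 3
      ≤ meanProfile f₀ 1 - meanProfile f₀ r := by
    rw [meanProfile, meanProfile, ← intervalIntegral.integral_sub
      (hf.intervalIntegrable_mul_comp h1) (hf.intervalIntegrable_mul_comp hr)]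
    refine intervalIntegral.integral_mono_on zero_le_one
      (Continuous.intervalIntegrable (by fun_prop) _ _)
      ((hf.intervalIntegrable_mul_comp h1).sub (hf.intervalIntegrable_mul_comp hr)) fun s hs => ?_
    have hsub := hf.mul_sq_sub_sq_le (mul_nonneg hr.1 hs.1)
      (mul_le_of_le_one_left hs.1 hr.2) hs.2
    rw [one_mul]
    nlinarith [mul_le_mul_of_nonneg_left hsub hs.1]
  have hpow : ∫ s in (0 : ℝ)..1, c / 2 * (1 - r ^ 2) * s ^ 3 = c / 8 * (1 - r ^ 2) := by
    rw [intervalIntegral.integral_const_mul, integral_pow]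
    norm_num
    ring
  have hsq : c / 8 * (1 - r) ≤ c / 8 * (1 - r ^ 2) :=
    mul_le_mul_of_nonneg_left (by nlinarith [hr.1, hr.2]) (by linarith [hf.const_pos])
  linarith [hf.meanProfile_le_kappa₂ h1]

lemma aemeasurable_mu (hf : IsQuadraticProfile f₀ c W) (Ω : ℝ) :
    AEMeasurable (mu f₀ Ω) unitVol :=
  hf.isBoundedWeight_derivOverR.aemeasurable.div
    (aemeasurable_const.sub hf.aemeasurable_meanProfile)

lemma exists_le_abs_sub_meanProfile (hf : IsQuadraticProfile f₀ c W)
    (hΩ : Ω ∉ Icc (kappa₁ f₀) (kappa₂ f₀)) :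
    ∃ δ > 0, ∀ r ∈ Icc (0 : ℝ) 1, δ ≤ |Ω - meanProfile f₀ r| := by
  rcases lt_or_ge Ω (kappa₁ f₀) with hlt | hge
  · refine ⟨kappa₁ f₀ - Ω, sub_pos.2 hlt, fun r hr => ?_⟩
    rw [abs_sub_comm]
    exact (sub_le_sub_right (hf.kappa₁_le_meanProfile hr) Ω).trans (le_abs_self _)
  · have hgt : kappa₂ f₀ < Ω := not_le.1 fun hle => hΩ ⟨hge, hle⟩
    exact ⟨Ω - kappa₂ f₀, sub_pos.2 hgt, fun r hr =>
      (sub_le_sub_left (hf.meanProfile_le_kappa₂ hr) Ω).trans (le_abs_self _)⟩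

lemma exists_isBoundedWeight_nu (hf : IsQuadraticProfile f₀ c W)
    (hΩ : Ω ∉ Icc (kappa₁ f₀) (kappa₂ f₀)) : ∃ C, IsBoundedWeight (nu f₀ Ω) C := by
  obtain ⟨δ, hδ, hgap⟩ := hf.exists_le_abs_sub_meanProfile hΩ
  have hnu : ∀ s ∈ Ioo (0 : ℝ) 1, nu f₀ Ω s = derivOverR f₀ s / |Ω - meanProfile f₀ s| :=
    fun s hs => by rw [nu, mu, abs_div, abs_of_pos (hf.derivOverR_pos hs)]
  refine ⟨W / δ, ⟨(hf.aemeasurable_mu Ω).norm, fun s hs => ?_⟩, fun s hs => ?_⟩ <;>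
    have hgap' := hgap s (Ioo_subset_Icc_self hs)
  · rw [hnu s hs]
    exact div_pos (hf.derivOverR_pos hs) (hδ.trans_le hgap')
  · rw [hnu s hs]
    exact div_le_div₀ hf.isBoundedWeight_derivOverR.const_pos.le (hf.le_const s hs) hδ hgap'

/-- At the threshold `Ω = κ₂` the weight `μ_Ω` has at most a simple pole, at `r = 1`. -/
lemma isFinitePotentialWeight_mu_kappa₂ (hf : IsQuadraticProfile f₀ c W) :
    IsFinitePotentialWeight (mu f₀ (kappa₂ f₀)) := by
  have hgap : ∀ s ∈ Ioo (0 : ℝ) 1, 0 < c / 8 * (1 - s) := fun s hs =>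
    mul_pos (by linarith [hf.const_pos]) (sub_pos.2 hs.2)
  refine IsRadialWeight.isFinitePotentialWeight_of_le_div (C := W / (c / 8))
    ⟨hf.aemeasurable_mu _, fun s hs => ?_⟩ fun s hs => ?_ <;>
    have hle := hf.mul_one_sub_le_kappa₂_sub_meanProfile (Ioo_subset_Icc_self hs)
  · exact div_pos (hf.derivOverR_pos hs) ((hgap s hs).trans_le hle)
  · rw [div_div]
    exact div_le_div₀ hf.isBoundedWeight_derivOverR.const_pos.le (hf.le_const s hs) (hgap s hs) hle

end IsQuadraticProfile

lemma one_div_mu_eq_add (f₀ : ℝ → ℝ) (Ω s : ℝ) :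
    1 / mu f₀ Ω s = (Ω - kappa₂ f₀) / derivOverR f₀ s + 1 / mu f₀ (kappa₂ f₀) s := by
  rw [mu, mu, one_div_div, one_div_div, ← add_div, sub_add_sub_cancel]

end Profile

section Kernel

namespace IsQuadraticProfile

variable {f₀ : ℝ → ℝ} {c W Ω : ℝ}

lemma mem_kerL₀_iff (hf : IsQuadraticProfile f₀ c W) (hΩ : Ω ∉ Icc (kappa₁ f₀) (kappa₂ f₀))
    {h : L2 f₀ Ω} :
    h ∈ kerL₀ f₀ Ω ↔ ∀ᵐ s ∂unitVol, radialPotential h s = 1 / mu f₀ Ω s * h s := by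
  obtain ⟨C, hv⟩ := hf.exists_isBoundedWeight_nu hΩ
  have hae : ae (lam f₀ Ω) = ae unitVol := hv.ae_eq
  change (∀ᵐ s ∂lam f₀ Ω, h s / mu f₀ Ω s - radialPotential h s = 0) ↔ _
  rw [hae]
  exact Filter.eventually_congr (.of_forall fun s => by
    rw [one_div_mul_eq_div, sub_eq_zero, eq_comm])

lemma zero_mem_kerL₀ (hf : IsQuadraticProfile f₀ c W) (hΩ : Ω ∉ Icc (kappa₁ f₀) (kappa₂ f₀)) :
    0 ∈ kerL₀ f₀ Ω := by
  obtain ⟨C, hv⟩ := hf.exists_isBoundedWeight_nu hΩ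
  have hzero : ⇑(0 : L2 f₀ Ω) =ᵐ[unitVol] 0 := hv.ae_eq ▸ Lp.coeFn_zero ℝ 2 (lam f₀ Ω)
  rw [hf.mem_kerL₀_iff hΩ]
  filter_upwards [hzero, ae_unitVol_mem] with s hs hs'
  rw [radialPotential_congr hzero (Ioo_subset_Icc_self hs'), hs]
  simp [radialPotential, radialAverage]

lemma kerL₀_eq_of_lt_kappa₁ (hf : IsQuadraticProfile f₀ c W) (hΩ : Ω < kappa₁ f₀) :
    kerL₀ f₀ Ω = {0} := by
  have hΩ' : Ω ∉ Icc (kappa₁ f₀) (kappa₂ f₀) := fun h => h.1.not_gt hΩ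
  obtain ⟨C, hv⟩ := hf.exists_isBoundedWeight_nu hΩ'
  refine eq_singleton_iff_unique_mem.2 ⟨hf.zero_mem_kerL₀ hΩ', fun h hh => ?_⟩
  refine hv.eq_zero_of_mul_radialPotential_eq_neg (h := h) ?_
  filter_upwards [(hf.mem_kerL₀_iff hΩ').1 hh, ae_unitVol_mem] with s hker hs
  have hmu : mu f₀ Ω s < 0 := div_neg_of_pos_of_neg (hf.derivOverR_pos hs)
    (by linarith [hf.kappa₁_le_meanProfile (Ioo_subset_Icc_self hs)])
  refine (congrArg _ hker).trans ?_
  rw [nu, abs_of_neg hmu, one_div, neg_mul]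
  exact congrArg _ (mul_inv_cancel_left₀ hmu.ne _)

lemma nu_le_mul_derivOverR (hf : IsQuadraticProfile f₀ c W) (hΩ : kappa₂ f₀ < Ω) {s : ℝ}
    (hs : s ∈ Ioo (0 : ℝ) 1) : nu f₀ Ω s ≤ (Ω - kappa₂ f₀)⁻¹ * derivOverR f₀ s := by
  have hpos := sub_pos.2 hΩ
  have hle : Ω - kappa₂ f₀ ≤ Ω - meanProfile f₀ s :=
    sub_le_sub_left (hf.meanProfile_le_kappa₂ (Ioo_subset_Icc_self hs)) Ω
  rw [nu, mu, abs_of_pos (div_pos (hf.derivOverR_pos hs) (hpos.trans_le hle)), inv_mul_eq_div]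
  exact div_le_div_of_nonneg_left (hf.derivOverR_pos hs).le hpos hle

lemma derivOverR_le_mul_mu_kappa₂ (hf : IsQuadraticProfile f₀ c W) {s : ℝ}
    (hs : s ∈ Ioo (0 : ℝ) 1) :
    derivOverR f₀ s ≤ (kappa₂ f₀ - kappa₁ f₀) * mu f₀ (kappa₂ f₀) s := by
  have hs' := Ioo_subset_Icc_self hs
  have hpos : 0 < kappa₂ f₀ - meanProfile f₀ s :=
    (mul_pos (by linarith [hf.const_pos]) (sub_pos.2 hs.2)).trans_le
      (hf.mul_one_sub_le_kappa₂_sub_meanProfile hs')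
  rw [mu, ← mul_div_assoc, le_div_iff₀ hpos, mul_comm]
  exact mul_le_mul_of_nonneg_right (sub_le_sub_left (hf.kappa₁_le_meanProfile hs') _)
    (hf.derivOverR_pos hs).le

lemma exists_radialPotential_eq (hf : IsQuadraticProfile f₀ c W) (hΩ : kappa₂ f₀ < Ω)
    (hker : kerL₀ f₀ Ω ≠ {0}) :
    ∃ h : Lp ℝ 2 (radialMeasure (derivOverR f₀)), h ≠ 0 ∧ ∀ᵐ s ∂unitVol, radialPotential h s
      = ((Ω - kappa₂ f₀) / derivOverR f₀ s + 1 / mu f₀ (kappa₂ f₀) s) * h s := by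
  have hΩ' : Ω ∉ Icc (kappa₁ f₀) (kappa₂ f₀) := fun h => h.2.not_gt hΩ
  obtain ⟨C, hv⟩ := hf.exists_isBoundedWeight_nu hΩ'
  have hw := hf.isBoundedWeight_derivOverR
  obtain ⟨h, hne, hh⟩ : ∃ h : Lp ℝ 2 (radialMeasure (nu f₀ Ω)), h ≠ 0 ∧
      ∀ᵐ s ∂unitVol, radialPotential h s = 1 / mu f₀ Ω s * h s := by
    by_contra hall
    refine hker (eq_singleton_iff_unique_mem.2 ⟨hf.zero_mem_kerL₀ hΩ', fun h hh => ?_⟩)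
    exact by_contra fun hne => hall ⟨h, hne, (hf.mem_kerL₀_iff hΩ').1 hh⟩
  have hcoe := weightEmbedding_ae_eq hv.toIsRadialWeight hw.toIsRadialWeight
    (fun s => hf.nu_le_mul_derivOverR hΩ) h
  refine ⟨weightEmbedding hv.toIsRadialWeight hw.toIsRadialWeight
    (fun s => hf.nu_le_mul_derivOverR hΩ) h, fun hzero => hne ?_, ?_⟩
  · refine Lp.eq_zero_iff_ae_eq_zero.2 (hv.ae_eq ▸ hcoe.symm.trans ?_)
    exact hw.ae_eq ▸ Lp.eq_zero_iff_ae_eq_zero.1 hzero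
  · filter_upwards [hcoe, hh, ae_unitVol_mem] with s hs hpot hsm
    rw [radialPotential_congr hcoe (Ioo_subset_Icc_self hsm), hpot, hs, one_div_mu_eq_add]

lemma finite_setOf_kerL₀_ne (hf : IsQuadraticProfile f₀ c W) :
    {Ω | kappa₂ f₀ < Ω ∧ kerL₀ f₀ Ω ≠ {0}}.Finite := by
  refine ((finite_setOf_radialPotential_eq hf.isBoundedWeight_derivOverR
    hf.isFinitePotentialWeight_mu_kappa₂ fun s => hf.derivOverR_le_mul_mu_kappa₂).preimage
    (sub_left_injective (b := kappa₂ f₀)).injOn).subset ?_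
  exact fun Ω ⟨hΩ, hker⟩ => ⟨sub_pos.2 hΩ, hf.exists_radialPotential_eq hΩ hker⟩

end IsQuadraticProfile

end Kernel

end RadialVortex

end

theorem proposition4p2_general {f₀ : ℝ → ℝ} {c W : ℝ} (hf : IsQuadraticProfile f₀ c W) :
    (∀ Ω : ℝ, Ω ∉ Icc (kappa₁ f₀) (kappa₂ f₀) →
      (∀ h : L2 f₀ Ω,
        IntervalIntegrable (fun s => s * h s) volume 0 1 ∧
        IntervalIntegrable (radialAverage h) volume 0 1) ∧
      ∃ T : L2 f₀ Ω →L[ℝ] L2 f₀ Ω,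
        (∀ h : L2 f₀ Ω, T h =ᵐ[lam f₀ Ω] calL₀ f₀ Ω h) ∧
        IsSelfAdjoint T ∧
        (∀ h : L2 f₀ Ω, h ≠ 0 → 0 < inner ℝ (T h) h) ∧
        IsCompactOperator T ∧
        IsHilbertSchmidt T) ∧
    (∀ Ω : ℝ, Ω < kappa₁ f₀ → kerL₀ f₀ Ω = {0}) ∧
    (∃ S : Set ℝ, S.Finite ∧ S ⊆ Ioi (kappa₂ f₀) ∧
      ∀ Ω ∈ Ioi (kappa₂ f₀) \ S, kerL₀ f₀ Ω = {0}) := by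
  refine ⟨fun Ω hΩ => ?_, fun Ω hΩ => hf.kerL₀_eq_of_lt_kappa₁ hΩ,
    {Ω | kappa₂ f₀ < Ω ∧ kerL₀ f₀ Ω ≠ {0}}, hf.finite_setOf_kerL₀_ne, fun Ω hΩ => hΩ.1,
    fun Ω hΩ => by_contra fun hker => hΩ.2 ⟨hΩ.1, hker⟩⟩
  obtain ⟨C, hv⟩ := hf.exists_isBoundedWeight_nu hΩ
  exact ⟨fun h => ⟨hv.intervalIntegrable_mul h, hv.intervalIntegrable_radialAverage h⟩,
    hv.potentialOp, fun h => hv.ae_eq ▸ hv.potentialOp_ae_eq h, hv.isSelfAdjoint_potentialOp,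
    fun h hh => hv.inner_potentialOp_self_pos hh, hv.isHilbertSchmidt_potentialOp.isCompactOperator,
    hv.isHilbertSchmidt_potentialOp⟩

theorem proposition4p2 (β : NNReal) (hβ0 : 0 < β) (hβ1 : β < 1) (f₀ : ℝ → ℝ)
    (hH1 : SmoothProfile β f₀) (hH2 : MonotoneProfile f₀) :
    (∀ Ω : ℝ, Ω ∉ Set.Icc (kappa₁ f₀) (kappa₂ f₀) →
      (∀ h : L2 f₀ Ω,
        IntervalIntegrable (fun s => s * h s) MeasureTheory.volume 0 1 ∧
        IntervalIntegrable (radialAverage h) MeasureTheory.volume 0 1) ∧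
      ∃ T : L2 f₀ Ω →L[ℝ] L2 f₀ Ω,
        (∀ h : L2 f₀ Ω, T h =ᵐ[lam f₀ Ω] calL₀ f₀ Ω h) ∧
        IsSelfAdjoint T ∧
        (∀ h : L2 f₀ Ω, h ≠ 0 → 0 < inner ℝ (T h) h) ∧
        IsCompactOperator T ∧
        IsHilbertSchmidt T) ∧
    (∀ Ω : ℝ, Ω < kappa₁ f₀ → kerL₀ f₀ Ω = {0}) ∧
    (∃ S : Set ℝ, S.Finite ∧ S ⊆ Set.Ioi (kappa₂ f₀) ∧
      ∀ Ω ∈ Set.Ioi (kappa₂ f₀) \ S, kerL₀ f₀ Ω = {0}) := by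
  obtain ⟨c, W, hf⟩ := hH1.exists_isQuadraticProfile hH2
  exact proposition4p2_general hf
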